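/- Let $(M,\omega)$ be a smooth symplectic manifold and let $J$ be a positive compatible almost complex structure on it: a smooth field of endomorphisms of $TM$ with $J^2=-\mathrm{Id}$ such that $g_J(X,Y):=\omega(X,JY)$ is a Riemannian metric on $M$. Let $\nabla^{g_J}$ be the Levi-Civita connection of $g_J$, and let $$N^J(X,Y)=[JX,JY]-J[JX,Y]-J[X,JY]-[X,Y]$$ be the Nijenhuis tensor of $J$. If $N^J$ is parallel for $\nabla^{g_J}$, then the integrability condition $N^J=0$ holds identically on $M$; that is, $$\nabla^{g_J}N^J=0\iff N^J=0.$$ -/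

import Mathlib

open Bundle FiberBundle VectorField
open scoped Manifold ContDiff Topology

noncomputable section

namespace AlmostKahler

variable {E : Type*} [NormedAddCommGroup E] [NormedSpace ℝ E]
  {H : Type*} [TopologicalSpace H] {I : ModelWithCorners ℝ E H}
  {M : Type*} [TopologicalSpace M] [ChartedSpace H M]

/-! ### Symplectic forms and almost complex structures -/

/-- The exterior derivative `dΩ(X, Y, Z)` of a 2-form `Ω`, evaluated on vector fields by the
invariant formula. -/
def extDerivTwoForm (Ω : Π x : M, TangentSpace I x →L[ℝ] TangentSpace I x →L[ℝ] ℝ)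
    (X Y Z : Π x : M, TangentSpace I x) (x : M) : ℝ :=
  d% (fun y ↦ Ω y (Y y) (Z y)) x (X x) - d% (fun y ↦ Ω y (X y) (Z y)) x (Y x)
    + d% (fun y ↦ Ω y (X y) (Y y)) x (Z x)
    - Ω x (mlieBracket I X Y x) (Z x) + Ω x (mlieBracket I X Z x) (Y x)
    - Ω x (mlieBracket I Y Z x) (X x)

/-- `Ω` is a symplectic form: a smooth, alternating, nondegenerate and closed 2-form. -/
structure IsSymplecticForm [IsManifold I ∞ M]
    (Ω : Π x : M, TangentSpace I x →L[ℝ] TangentSpace I x →L[ℝ] ℝ) : Prop where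
  contMDiff : ContMDiff I (I.prod 𝓘(ℝ, E →L[ℝ] E →L[ℝ] ℝ)) ∞
    (fun x ↦ TotalSpace.mk' (E →L[ℝ] E →L[ℝ] ℝ)
      (E := fun x : M ↦ TangentSpace I x →L[ℝ] TangentSpace I x →L[ℝ] ℝ) x (Ω x))
  alternating : ∀ (x : M) (v : TangentSpace I x), Ω x v v = 0
  nondegenerate : ∀ (x : M) (v : TangentSpace I x), (∀ w, Ω x v w = 0) → v = 0
  closed : ∀ (X Y Z : Π x : M, TangentSpace I x) (x : M),
    CMDiffAt ∞ (T% X) x → CMDiffAt ∞ (T% Y) x → CMDiffAt ∞ (T% Z) x →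
      extDerivTwoForm Ω X Y Z x = 0

/-- `J` is an almost complex structure: a smooth field of endomorphisms of the tangent bundle
with `J² = -1`. -/
structure IsAlmostComplex [IsManifold I ∞ M]
    (J : Π x : M, TangentSpace I x →L[ℝ] TangentSpace I x) : Prop where
  contMDiff : ContMDiff I (I.prod 𝓘(ℝ, E →L[ℝ] E)) ∞
    (fun x ↦ TotalSpace.mk' (E →L[ℝ] E)
      (E := fun x : M ↦ TangentSpace I x →L[ℝ] TangentSpace I x) x (J x))
  sq : ∀ (x : M) (v : TangentSpace I x), J x (J x v) = -v

/-- The tensor `g_J(u, v) = Ω(u, J v)`. -/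
def compatibleTensor (Ω : Π x : M, TangentSpace I x →L[ℝ] TangentSpace I x →L[ℝ] ℝ)
    (J : Π x : M, TangentSpace I x →L[ℝ] TangentSpace I x) (x : M) :
    TangentSpace I x →L[ℝ] TangentSpace I x →L[ℝ] ℝ :=
  ContinuousLinearMap.precomp ℝ (J x) ∘L Ω x

@[simp]
theorem compatibleTensor_apply
    (Ω : Π x : M, TangentSpace I x →L[ℝ] TangentSpace I x →L[ℝ] ℝ)
    (J : Π x : M, TangentSpace I x →L[ℝ] TangentSpace I x) (x : M) (u v : TangentSpace I x) :
    compatibleTensor Ω J x u v = Ω x u (J x v) := rfl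

/-- `J` is compatible with `Ω` (the tensor `g_J` is symmetric) and positive (`g_J` is positive
definite). -/
structure IsPositiveCompatible
    (Ω : Π x : M, TangentSpace I x →L[ℝ] TangentSpace I x →L[ℝ] ℝ)
    (J : Π x : M, TangentSpace I x →L[ℝ] TangentSpace I x) : Prop where
  symm : ∀ (x : M) (u v : TangentSpace I x),
    compatibleTensor Ω J x u v = compatibleTensor Ω J x v u
  pos : ∀ (x : M) (v : TangentSpace I x), v ≠ 0 → 0 < compatibleTensor Ω J x v v

section Metric

theorem isVonNBounded_of_posDef {V : Type*} [NormedAddCommGroup V] [NormedSpace ℝ V]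
    [FiniteDimensional ℝ V] (g : V →L[ℝ] V →L[ℝ] ℝ) (pos : ∀ v, v ≠ 0 → 0 < g v v) :
    Bornology.IsVonNBounded ℝ {v : V | g v v < 1} := by
  rw [NormedSpace.isVonNBounded_iff']
  rcases subsingleton_or_nontrivial V with hV | hV
  · exact ⟨0, fun v _ ↦ by simp [Subsingleton.elim v 0]⟩
  have hc : Continuous fun v : V ↦ g v v := by fun_prop
  obtain ⟨u, hu, hmin⟩ := (isCompact_sphere (0 : V) 1).exists_isMinOn
    (NormedSpace.sphere_nonempty.2 zero_le_one) hc.continuousOn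
  have hu1 : ‖u‖ = 1 := by simpa using hu
  have hpos : 0 < g u u := pos u (by rintro rfl; simp at hu1)
  refine ⟨1 + (g u u)⁻¹, fun v hv ↦ ?_⟩
  rcases eq_or_ne v 0 with rfl | h0
  · simp; positivity
  have hn : 0 < ‖v‖ := norm_pos_iff.2 h0
  have h1 : g u u ≤ g (‖v‖⁻¹ • v) (‖v‖⁻¹ • v) := hmin (by simp [norm_smul, hn.ne'])
  have h2 : g u u * ‖v‖ ^ 2 ≤ g v v := by
    simp only [map_smul, smul_apply, smul_eq_mul] at h1
    calc g u u * ‖v‖ ^ 2 ≤ ‖v‖⁻¹ * (‖v‖⁻¹ * g v v) * ‖v‖ ^ 2 := by gcongr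
      _ = g v v := by field_simp
  have hv' : g v v < 1 := hv
  have h3 : ‖v‖ ^ 2 ≤ (g u u)⁻¹ := by
    rw [← one_div, le_div_iff₀ hpos]; linarith
  nlinarith [sq_nonneg (‖v‖ - 1)]

variable [IsManifold I ∞ M]

theorem contMDiff_compatibleTensor
    {Ω : Π x : M, TangentSpace I x →L[ℝ] TangentSpace I x →L[ℝ] ℝ}
    {J : Π x : M, TangentSpace I x →L[ℝ] TangentSpace I x}
    (hΩ : IsSymplecticForm Ω) (hJ : IsAlmostComplex J) :
    ContMDiff I (I.prod 𝓘(ℝ, E →L[ℝ] E →L[ℝ] ℝ)) ∞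
      (fun x ↦ TotalSpace.mk' (E →L[ℝ] E →L[ℝ] ℝ)
        (E := fun x : M ↦ TangentSpace I x →L[ℝ] TangentSpace I x →L[ℝ] ℝ) x
        (compatibleTensor Ω J x)) := by
  intro x₀
  have h1 := (contMDiffAt_hom_bundle _).1 (hΩ.contMDiff x₀)
  have h2 := (contMDiffAt_hom_bundle _).1 (hJ.contMDiff x₀)
  refine (contMDiffAt_hom_bundle _).2 ⟨contMDiffAt_id, ?_⟩
  have h3 := (h2.2.clm_precomp (F₃ := ℝ)).clm_comp h1.2
  refine h3.congr_of_eventuallyEq ?_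
  have hb : (trivializationAt E (TangentSpace I : M → Type _) x₀).baseSet ∈ 𝓝 x₀ :=
    (Trivialization.open_baseSet _).mem_nhds (mem_baseSet_trivializationAt' x₀)
  filter_upwards [hb] with y hy
  ext u v
  have e1 := fun (A : TangentSpace I y →L[ℝ] TangentSpace I y →L[ℝ] ℝ) (a b : E) ↦
    inCoordinates_apply_eq₂ (F₃ := ℝ) (E₃ := Bundle.Trivial M ℝ) (ϕ := A) (v := a) (w := b)
      hy hy (Set.mem_univ y)
  refine (e1 _ u v).trans (Eq.trans ?_ (e1 (Ω y) u _).symm)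
  simp only [compatibleTensor_apply]
  congr 2
  rw [ContinuousLinearMap.inCoordinates_eq hy hy]
  exact (((trivializationAt E (TangentSpace I : M → Type _) x₀).continuousLinearEquivAt ℝ y
    hy).symm_apply_apply _).symm

variable [FiniteDimensional ℝ E]

/-- The Riemannian metric `g_J(u, v) = Ω(u, J v)` of a positive compatible almost complex
structure. -/
def compatibleMetric
    {Ω : Π x : M, TangentSpace I x →L[ℝ] TangentSpace I x →L[ℝ] ℝ}
    {J : Π x : M, TangentSpace I x →L[ℝ] TangentSpace I x}
    (hΩ : IsSymplecticForm Ω) (hJ : IsAlmostComplex J) (h : IsPositiveCompatible Ω J) :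
    ContMDiffRiemannianMetric I ∞ E (fun x : M ↦ TangentSpace I x) where
  inner := compatibleTensor Ω J
  symm := h.symm
  pos := h.pos
  isVonNBounded x := isVonNBounded_of_posDef (V := E) (compatibleTensor Ω J x) (h.pos x)
  contMDiff := contMDiff_compatibleTensor hΩ hJ

end Metric

/-! ### The Levi-Civita connection -/

section LeviCivita

variable [IsManifold I ∞ M]

theorem mdifferentiableAt_inner
    (g : ContMDiffRiemannianMetric I ∞ E (fun x : M ↦ TangentSpace I x))
    {Y Z : Π x : M, TangentSpace I x} {x : M} (hY : MDiffAt (T% Y) x) (hZ : MDiffAt (T% Z) x) :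
    MDiffAt (fun y ↦ g.inner y (Y y) (Z y)) x := by
  have h1 := (g.contMDiff x).mdifferentiableAt (by simp)
  have := MDifferentiableAt.clm_bundle_apply₂ (F₁ := E) (F₂ := E) (F₃ := ℝ)
    (E₃ := Bundle.Trivial M ℝ) h1 hY hZ
  exact ((mdifferentiableAt_totalSpace _ _).1 this).2

variable [FiniteDimensional ℝ E]

/-- `cov` is torsion free and preserves the metric `g`.
Mathlib writes `cov Y x v` for the value at `x` of `∇_v Y`. -/
def IsLeviCivita (g : ContMDiffRiemannianMetric I ∞ E (fun x : M ↦ TangentSpace I x))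
    (cov : CovariantDerivative I E (TangentSpace I : M → Type _)) : Prop :=
  haveI : CompleteSpace E := FiniteDimensional.complete ℝ E
  cov.torsion = 0 ∧
    ∀ (Y Z : Π x : M, TangentSpace I x) (x : M) (v : TangentSpace I x),
      MDiffAt (T% Y) x → MDiffAt (T% Z) x →
        d% (fun y ↦ g.inner y (Y y) (Z y)) x v =
          g.inner x (cov Y x v) (Z x) + g.inner x (Y x) (cov Z x v)

/-- The right-hand side of the Koszul formula for `2 g(∇_X Y, Z)`. -/
def koszul (g : ContMDiffRiemannianMetric I ∞ E (fun x : M ↦ TangentSpace I x))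
    (Y : Π x : M, TangentSpace I x) (x : M) (X Z : Π x : M, TangentSpace I x) : ℝ :=
  d% (fun y ↦ g.inner y (Y y) (Z y)) x (X x) + d% (fun y ↦ g.inner y (Z y) (X y)) x (Y x)
    - d% (fun y ↦ g.inner y (X y) (Y y)) x (Z x)
    + g.inner x (mlieBracket I X Y x) (Z x) - g.inner x (mlieBracket I X Z x) (Y x)
    - g.inner x (mlieBracket I Y Z x) (X x)

variable (g : ContMDiffRiemannianMetric I ∞ E (fun x : M ↦ TangentSpace I x))
  {X Y Z : Π x : M, TangentSpace I x} {x : M}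

theorem koszul_tensorial_left (hY : MDiffAt (T% Y) x) (hZ : MDiffAt (T% Z) x) :
    TensorialAt I E (koszul g Y x · Z) x where
  smul {f X} hf hX := by
    have : CompleteSpace E := FiniteDimensional.complete ℝ E
    have e1 : (fun y ↦ g.inner y (Z y) ((f • X) y)) = fun y ↦ f y * g.inner y (Z y) (X y) := by
      ext y; simp
    have e2 : (fun y ↦ g.inner y ((f • X) y) (Y y)) = fun y ↦ f y * g.inner y (X y) (Y y) := by
      ext y; simp
    simp only [koszul, e1, e2, mvfderiv_fun_mul hf (mdifferentiableAt_inner g hZ hX),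
      mvfderiv_fun_mul hf (mdifferentiableAt_inner g hX hY), mlieBracket_smul_left hf hX]
    simp [g.symm x (X x) (Y x), g.symm x (X x) (Z x)]
    ring
  add {X X'} hX hX' := by
    have : CompleteSpace E := FiniteDimensional.complete ℝ E
    have e1 : (fun y ↦ g.inner y (Z y) ((X + X') y)) =
        fun y ↦ g.inner y (Z y) (X y) + g.inner y (Z y) (X' y) := by
      ext y; simp
    have e2 : (fun y ↦ g.inner y ((X + X') y) (Y y)) =
        fun y ↦ g.inner y (X y) (Y y) + g.inner y (X' y) (Y y) := by
      ext y; simp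
    simp only [koszul, e1, e2,
      mvfderiv_fun_add (mdifferentiableAt_inner g hZ hX) (mdifferentiableAt_inner g hZ hX'),
      mvfderiv_fun_add (mdifferentiableAt_inner g hX hY) (mdifferentiableAt_inner g hX' hY),
      mlieBracket_add_left hX hX']
    simp
    ring

theorem koszul_tensorial_right (hY : MDiffAt (T% Y) x) (hX : MDiffAt (T% X) x) :
    TensorialAt I E (koszul g Y x X ·) x where
  smul {f Z} hf hZ := by
    have : CompleteSpace E := FiniteDimensional.complete ℝ E
    have e1 : (fun y ↦ g.inner y ((f • Z) y) (X y)) = fun y ↦ f y * g.inner y (Z y) (X y) := by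
      ext y; simp
    have e2 : (fun y ↦ g.inner y (Y y) ((f • Z) y)) = fun y ↦ f y * g.inner y (Y y) (Z y) := by
      ext y; simp
    simp only [koszul, e1, e2, mvfderiv_fun_mul hf (mdifferentiableAt_inner g hZ hX),
      mvfderiv_fun_mul hf (mdifferentiableAt_inner g hY hZ), mlieBracket_smul_right hf hZ]
    simp [g.symm x (Z x) (Y x), g.symm x (Z x) (X x)]
    ring
  add {Z Z'} hZ hZ' := by
    have : CompleteSpace E := FiniteDimensional.complete ℝ E
    have e1 : (fun y ↦ g.inner y ((Z + Z') y) (X y)) =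
        fun y ↦ g.inner y (Z y) (X y) + g.inner y (Z' y) (X y) := by
      ext y; simp
    have e2 : (fun y ↦ g.inner y (Y y) ((Z + Z') y)) =
        fun y ↦ g.inner y (Y y) (Z y) + g.inner y (Y y) (Z' y) := by
      ext y; simp
    simp only [koszul, e1, e2,
      mvfderiv_fun_add (mdifferentiableAt_inner g hZ hX) (mdifferentiableAt_inner g hZ' hX),
      mvfderiv_fun_add (mdifferentiableAt_inner g hY hZ) (mdifferentiableAt_inner g hY hZ'),
      mlieBracket_add_right hZ hZ']
    simp
    ring

theorem exists_sharp {V : Type*} [NormedAddCommGroup V] [NormedSpace ℝ V]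
    [FiniteDimensional ℝ V] (g : V →L[ℝ] V →L[ℝ] ℝ) (pos : ∀ v, v ≠ 0 → 0 < g v v)
    (B : V →L[ℝ] V →L[ℝ] ℝ) : ∃ A : V →L[ℝ] V, ∀ v w, g (A v) w = B v w := by
  have hinj : Function.Injective (g : V →ₗ[ℝ] V →L[ℝ] ℝ) := by
    rw [injective_iff_map_eq_zero]
    intro v hv
    by_contra h
    have h1 := pos v h
    have h2 : g v = 0 := hv
    simp [h2] at h1
  have hdim : Module.finrank ℝ V = Module.finrank ℝ (V →L[ℝ] ℝ) := by
    rw [← (LinearMap.toContinuousLinearMap : (V →ₗ[ℝ] ℝ) ≃ₗ[ℝ] (V →L[ℝ] ℝ)).finrank_eq]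
    exact (Subspace.dual_finrank_eq (K := ℝ) (V := V)).symm
  let L := LinearEquiv.ofInjectiveOfFinrankEq (g : V →ₗ[ℝ] V →L[ℝ] ℝ) hinj hdim
  refine ⟨LinearMap.toContinuousLinearMap (L.symm.toLinearMap ∘ₗ (B : V →ₗ[ℝ] V →L[ℝ] ℝ)),
    fun v w ↦ ?_⟩
  have : g (L.symm (B v)) = B v := L.apply_symm_apply (B v)
  exact congrArg (fun f : V →L[ℝ] ℝ ↦ f w) this

theorem exists_sharp_tangent (x : M) (B : TangentSpace I x →L[ℝ] TangentSpace I x →L[ℝ] ℝ) :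
    ∃ A : TangentSpace I x →L[ℝ] TangentSpace I x, ∀ v w, g.inner x (A v) w = B v w :=
  exists_sharp (V := E) (g.inner x) (g.pos x) B

/-- Every smooth Riemannian metric has a Levi-Civita connection. -/
theorem exists_isLeviCivita :
    ∃ cov : CovariantDerivative I E (TangentSpace I : M → Type _), IsLeviCivita g cov := by
  have : CompleteSpace E := FiniteDimensional.complete ℝ E
  have key : ∀ (Y : Π x : M, TangentSpace I x) (x : M),
      ∃ A : TangentSpace I x →L[ℝ] TangentSpace I x, MDiffAt (T% Y) x →
        ∀ X Z : Π x : M, TangentSpace I x, MDiffAt (T% X) x → MDiffAt (T% Z) x →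
          2 * g.inner x (A (X x)) (Z x) = koszul g Y x X Z := by
    intro Y x
    by_cases hY : MDiffAt (T% Y) x
    · obtain ⟨A, hA⟩ := exists_sharp_tangent g x ((2⁻¹ : ℝ) • TensorialAt.mkHom₂ (koszul g Y x) x
        (fun Z hZ ↦ koszul_tensorial_left g hY hZ) (fun X hX ↦ koszul_tensorial_right g hY hX))
      refine ⟨A, fun _ X Z hX hZ ↦ ?_⟩
      rw [hA]
      have := TensorialAt.mkHom₂_apply (fun Z hZ ↦ koszul_tensorial_left g hY hZ)
        (fun X hX ↦ koszul_tensorial_right g hY hX) hX hZ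
      simp only [smul_apply, this, smul_eq_mul]
      ring
    · exact ⟨0, fun h ↦ absurd h hY⟩
  choose cov hcov using key
  have ext_eq : ∀ {x : M} {A B : TangentSpace I x →L[ℝ] TangentSpace I x},
      (∀ X Z : Π x : M, TangentSpace I x, MDiffAt (T% X) x → MDiffAt (T% Z) x →
        2 * g.inner x (A (X x)) (Z x) = 2 * g.inner x (B (X x)) (Z x)) → A = B := by
    intro x A B h
    ext v
    have h1 := h (extend E v) (extend E (A v - B v)) (mdifferentiableAt_extend ..)
      (mdifferentiableAt_extend ..)
    simp only [extend_apply_self] at h1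
    by_contra hne
    have := g.pos x (A v - B v) (sub_ne_zero.2 hne)
    have h2 := map_sub (g.inner x (A v - B v)) (A v) (B v)
    rw [g.symm x _ (A v), g.symm x _ (B v)] at h2
    linarith
  have hcd : IsCovariantDerivativeOn E cov := by
    refine ⟨fun {Y Y' x} hY hY' _ ↦ ?_, fun {Y f x} hY hf _ ↦ ?_⟩
    · apply ext_eq
      intro X Z hX hZ
      have e1 : (fun y ↦ g.inner y ((Y + Y') y) (Z y)) =
          fun y ↦ g.inner y (Y y) (Z y) + g.inner y (Y' y) (Z y) := by
        ext y; simp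
      have e2 : (fun y ↦ g.inner y (X y) ((Y + Y') y)) =
          fun y ↦ g.inner y (X y) (Y y) + g.inner y (X y) (Y' y) := by
        ext y; simp
      rw [hcov _ _ (mdifferentiableAt_add_section hY hY') X Z hX hZ]
      simp only [add_apply, map_add, mul_add,
        hcov _ _ hY X Z hX hZ, hcov _ _ hY' X Z hX hZ]
      simp only [koszul, e1, e2,
        mvfderiv_fun_add (mdifferentiableAt_inner g hY hZ) (mdifferentiableAt_inner g hY' hZ),
        mvfderiv_fun_add (mdifferentiableAt_inner g hX hY) (mdifferentiableAt_inner g hX hY'),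
        mlieBracket_add_left hY hY', mlieBracket_add_right hY hY']
      simp
      ring
    · apply ext_eq
      intro X Z hX hZ
      have e1 : (fun y ↦ g.inner y ((f • Y) y) (Z y)) = fun y ↦ f y * g.inner y (Y y) (Z y) := by
        ext y; simp
      have e2 : (fun y ↦ g.inner y (X y) ((f • Y) y)) = fun y ↦ f y * g.inner y (X y) (Y y) := by
        ext y; simp
      rw [hcov _ _ (hf.smul_section hY) X Z hX hZ]
      have h0 := hcov _ _ hY X Z hX hZ
      simp only [add_apply, map_add, mul_add, smul_apply,
        map_smul, smul_eq_mul, ContinuousLinearMap.smulRight_apply]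
      rw [mul_left_comm, h0]
      simp only [koszul, e1, e2,
        mvfderiv_fun_mul hf (mdifferentiableAt_inner g hY hZ),
        mvfderiv_fun_mul hf (mdifferentiableAt_inner g hX hY),
        mlieBracket_smul_left hf hY, mlieBracket_smul_right hf hY]
      simp [g.symm x (X x) (Y x)]
      ring
  have symm_fun : ∀ Y Z : Π x : M, TangentSpace I x,
      (fun y ↦ g.inner y (Y y) (Z y)) = fun y ↦ g.inner y (Z y) (Y y) :=
    fun Y Z ↦ funext fun y ↦ g.symm y _ _
  have neg_inner : ∀ (x : M) (a b : TangentSpace I x),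
      g.inner x (-a) b = - g.inner x a b := by
    intro x a b
    rw [g.symm, map_neg, g.symm]
  refine ⟨⟨cov, hcd⟩, ?_, ?_⟩
  · rw [CovariantDerivative.torsion_eq_zero_iff]
    intro X Y x hX hY
    change cov Y x (X x) - cov X x (Y x) = mlieBracket I X Y x
    by_contra hne
    rw [← sub_eq_zero] at hne
    obtain ⟨u, hu⟩ : ∃ u, u = cov Y x (X x) - cov X x (Y x) - mlieBracket I X Y x := ⟨_, rfl⟩
    rw [← hu] at hne
    have hU := mdifferentiableAt_extend I E u
    have h1 := hcov Y x hY X (extend E u) hX hU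
    have h2 := hcov X x hX Y (extend E u) hY hU
    have h3 := g.pos x u hne
    have h4 : g.inner x u u = g.inner x (cov Y x (X x)) u - g.inner x (cov X x (Y x)) u
        - g.inner x (mlieBracket I X Y x) u := by
      have h5 := congrArg (g.inner x u) hu
      rw [map_sub, map_sub] at h5
      rw [h5, g.symm x u, g.symm x u, g.symm x u]
    simp only [koszul, extend_apply_self] at h1 h2
    rw [symm_fun X (extend E u), symm_fun (extend E u) Y, symm_fun Y X,
      mlieBracket_swap_apply (V := Y) (W := X), neg_inner] at h2
    linarith
  · intro Y Z x v hY hZ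
    change _ = g.inner x (cov Y x v) (Z x) + g.inner x (Y x) (cov Z x v)
    have hX := mdifferentiableAt_extend I E v
    have h1 := hcov Y x hY (extend E v) Z hX hZ
    have h2 := hcov Z x hZ (extend E v) Y hX hY
    simp only [koszul, extend_apply_self] at h1 h2
    rw [symm_fun Z Y, symm_fun Y (extend E v), symm_fun (extend E v) Z,
      mlieBracket_swap_apply (V := Z) (W := Y), neg_inner] at h2
    rw [g.symm x (Y x)]
    linarith

/-- The Levi-Civita connection of `g`: the torsion-free connection preserving `g`. -/
def leviCivita : CovariantDerivative I E (TangentSpace I : M → Type _) :=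
  (exists_isLeviCivita g).choose

theorem leviCivita_spec : IsLeviCivita g (leviCivita g) := (exists_isLeviCivita g).choose_spec

end LeviCivita

/-! ### The Nijenhuis tensor -/

section Nijenhuis

/-- The Nijenhuis bracket `[JX,JY] - J[JX,Y] - J[X,JY] - [X,Y]` of vector fields. -/
def nijenhuisBracket (J : Π x : M, TangentSpace I x →L[ℝ] TangentSpace I x)
    (x : M) (X Y : Π x : M, TangentSpace I x) : TangentSpace I x :=
  mlieBracket I (fun y ↦ J y (X y)) (fun y ↦ J y (Y y)) x
    - J x (mlieBracket I (fun y ↦ J y (X y)) Y x)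
    - J x (mlieBracket I X (fun y ↦ J y (Y y)) x)
    - mlieBracket I X Y x

theorem nijenhuisBracket_swap (J : Π x : M, TangentSpace I x →L[ℝ] TangentSpace I x)
    (x : M) (X Y : Π x : M, TangentSpace I x) :
    nijenhuisBracket J x X Y = - nijenhuisBracket J x Y X := by
  simp only [nijenhuisBracket]
  rw [mlieBracket_swap_apply (V := fun y ↦ J y (X y)) (W := fun y ↦ J y (Y y)),
    mlieBracket_swap_apply (V := fun y ↦ J y (X y)) (W := Y),
    mlieBracket_swap_apply (V := X) (W := fun y ↦ J y (Y y)),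
    mlieBracket_swap_apply (V := X) (W := Y)]
  simp only [map_neg]
  abel

theorem IsAlmostComplex.mdifferentiableAt [IsManifold I ∞ M]
    {J : Π x : M, TangentSpace I x →L[ℝ] TangentSpace I x} (hJ : IsAlmostComplex J)
    {X : Π x : M, TangentSpace I x} {x : M} (hX : MDiffAt (T% X) x) :
    MDiffAt (T% (fun y ↦ J y (X y))) x :=
  MDifferentiableAt.clm_bundle_apply (F₁ := E) (F₂ := E)
    ((hJ.contMDiff x).mdifferentiableAt (by simp)) hX

variable [FiniteDimensional ℝ E] [IsManifold I ∞ M]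
  {J : Π x : M, TangentSpace I x →L[ℝ] TangentSpace I x}

theorem nijenhuisBracket_tensorial_left (hJ : IsAlmostComplex J) {x : M}
    (Y : Π x : M, TangentSpace I x) :
    TensorialAt I E (nijenhuisBracket J x · Y) x where
  smul {f X} hf hX := by
    have : CompleteSpace E := FiniteDimensional.complete ℝ E
    have e : (fun y ↦ J y ((f • X) y)) = f • (fun y ↦ J y (X y)) := by ext y; simp
    simp only [nijenhuisBracket, e, mlieBracket_smul_left hf hX,
      mlieBracket_smul_left hf (hJ.mdifferentiableAt hX)]
    simp only [map_add, map_smul, hJ.sq]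
    module
  add {X X'} hX hX' := by
    have : CompleteSpace E := FiniteDimensional.complete ℝ E
    have e : (fun y ↦ J y ((X + X') y)) = (fun y ↦ J y (X y)) + (fun y ↦ J y (X' y)) := by
      ext y; simp
    simp only [nijenhuisBracket, e, mlieBracket_add_left hX hX',
      mlieBracket_add_left (hJ.mdifferentiableAt hX) (hJ.mdifferentiableAt hX')]
    simp only [map_add]
    abel

theorem nijenhuisBracket_tensorial_right (hJ : IsAlmostComplex J) {x : M}
    (X : Π x : M, TangentSpace I x) :
    TensorialAt I E (nijenhuisBracket J x X) x where
  smul hf hY := by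
    rw [nijenhuisBracket_swap, (nijenhuisBracket_tensorial_left hJ X).smul hf hY,
      nijenhuisBracket_swap J x X, smul_neg]
  add hY hY' := by
    rw [nijenhuisBracket_swap, (nijenhuisBracket_tensorial_left hJ X).add hY hY',
      nijenhuisBracket_swap J x X, nijenhuisBracket_swap J x X, neg_add]

/-- The Nijenhuis tensor `N^J`: the tensor with
`N^J(X, Y) = [JX,JY] - J[JX,Y] - J[X,JY] - [X,Y]` for all vector fields `X`, `Y`. -/
def nijenhuis (hJ : IsAlmostComplex J) (x : M) :
    TangentSpace I x →L[ℝ] TangentSpace I x →L[ℝ] TangentSpace I x :=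
  TensorialAt.mkHom₂ (nijenhuisBracket J x) x
    (fun Y _ ↦ nijenhuisBracket_tensorial_left hJ Y)
    (fun X _ ↦ nijenhuisBracket_tensorial_right hJ X)

theorem nijenhuis_apply (hJ : IsAlmostComplex J) {X Y : Π x : M, TangentSpace I x} {x : M}
    (hX : MDiffAt (T% X) x) (hY : MDiffAt (T% Y) x) :
    nijenhuis hJ x (X x) (Y x) = nijenhuisBracket J x X Y :=
  TensorialAt.mkHom₂_apply _ _ hX hY

end Nijenhuis

/-- A (1,2)-tensor field `A` is parallel for the connection `∇` if
`(∇_v A)(Y, Z) = ∇_v (A(Y, Z)) - A(∇_v Y, Z) - A(Y, ∇_v Z)` vanishes for all tangent vectors `v`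
and all smooth vector fields `Y`, `Z`. -/
def IsParallel [IsManifold I ∞ M]
    (cov : CovariantDerivative I E (TangentSpace I : M → Type _))
    (A : Π x : M, TangentSpace I x →L[ℝ] TangentSpace I x →L[ℝ] TangentSpace I x) : Prop :=
  ∀ (x : M) (v : TangentSpace I x) (Y Z : Π x : M, TangentSpace I x),
    CMDiffAt ∞ (T% Y) x → CMDiffAt ∞ (T% Z) x →
      cov (fun y ↦ A y (Y y) (Z y)) x v - A x (cov Y x v) (Z x) - A x (Y x) (cov Z x v) = 0

end AlmostKahler

end

namespace AlmostKahler

/-! Write `g` for the compatible metric and `A_w = ∇_w J`. On an almost Kähler manifold, closedness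
of `Ω` makes `N` and `∇J` determine each other: `2 g(A_w y, z) = g(N(y, z), J w)`
(`IsLeviCivita.two_mul_covDerivEnd`). Moreover `A_w` is `g`-skew and anticommutes with `J`.

If `N` is parallel, differentiating `N(Jy, z) = -J N(y, z)` leaves only the derivatives of `J`:
`N(A_w y, z) = -A_w N(y, z)` (`IsParallel.covDerivEnd_nijenhuis`).

The rest is algebra in one tangent space. Substituting the second identity into the first gives `A_x
A_w = -A_{A_w x}`. For `x = w` the left side is the square of a skew map, hence symmetric, while the
right side is skew; so `A_w² = 0`. A skew map with zero square vanishes because `g` is definite, so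
`∇J = 0`, and the first identity gives `N = 0`. -/

/-! ### Linear algebra in a single tangent space -/

theorem eq_zero_of_compatible_derivation {V : Type*} [AddCommGroup V] [Module ℝ V]
    [TopologicalSpace V] [IsTopologicalAddGroup V] [ContinuousSMul ℝ V] (g : V →L[ℝ] V →L[ℝ] ℝ) (J : V →L[ℝ] V)
    (N : V →L[ℝ] V →L[ℝ] V) (A : V → V → V)
    (symm : ∀ u v, g u v = g v u) (pos : ∀ v, v ≠ 0 → 0 < g v v) (sq : ∀ v, J (J v) = -v)
    (hA : ∀ w y z, 2 * g (A w y) z = g (N y z) (J w))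
    (hAJ : ∀ w y, A w (J y) = -J (A w y))
    (hskew : ∀ w y z, g (A w y) z = -g y (A w z))
    (hN : ∀ w y z, N (A w y) z = -A w (N y z)) : N = 0 := by
  have eq_zero : ∀ v, g v v = 0 → v = 0 := fun v hv ↦ by
    by_contra h
    exact (pos v h).ne' hv
  -- Move `A w` from `N y z` onto `J x` by skewness, then past `J`; what remains is `hA` for the
  -- direction `A w x`.
  have comp : ∀ x w y z, g (A x (A w y)) z = -g (A (A w x) y) z := fun x w y z ↦ by
    have h1 := hA x (A w y) z
    have h2 := hA (A w x) y z
    have h3 := hskew w (N y z) (J x)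
    rw [hN, map_neg, neg_apply, h3, hAJ, map_neg] at h1
    linarith
  -- `h4` and `h5` make this form symmetric in `y` and `z`; `comp` and `h3` make it antisymmetric.
  have sq_zero : ∀ w y z, g (A w (A w y)) z = 0 := fun w y z ↦ by
    have h1 := comp w w y z
    have h2 := comp w w z y
    have h3 := hskew (A w w) y z
    have h4 := hskew w (A w y) z
    have h5 := hskew w y (A w z)
    rw [symm y] at h3 h5
    linarith
  have hzero : ∀ w y, A w y = 0 := fun w y ↦ eq_zero _ <| by
    have h1 := hskew w y (A w y)
    rw [symm y, sq_zero] at h1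
    simpa using h1
  ext y z
  refine eq_zero _ ?_
  -- This direction is chosen so that `J` sends it to `N y z`, turning the right side into a squared
  -- norm.
  have h := hA (-J (N y z)) y z
  rw [hzero, map_neg, sq, neg_neg] at h
  simpa using h.symm

variable {E : Type*} [NormedAddCommGroup E] [NormedSpace ℝ E]
  {H : Type*} [TopologicalSpace H] {I : ModelWithCorners ℝ E H}
  {M : Type*} [TopologicalSpace M] [ChartedSpace H M] [IsManifold I ∞ M]
  {Ω : Π x : M, TangentSpace I x →L[ℝ] TangentSpace I x →L[ℝ] ℝ}
  {J : Π x : M, TangentSpace I x →L[ℝ] TangentSpace I x}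

/-! ### Pointwise compatibility and the derivative of `J` -/

theorem IsSymplecticForm.swap (hΩ : IsSymplecticForm Ω) (x : M) (u v : TangentSpace I x) :
    Ω x u v = -Ω x v u := by
  have h := hΩ.alternating x (u + v)
  simp only [map_add, add_apply, hΩ.alternating] at h
  linarith

theorem IsPositiveCompatible.apply_left (hΩ : IsSymplecticForm Ω)
    (h : IsPositiveCompatible Ω J) (x : M) (u v : TangentSpace I x) :
    Ω x (J x u) v = -Ω x u (J x v) := by
  have h1 := h.symm x u v
  simp only [compatibleTensor_apply] at h1
  rw [h1, hΩ.swap]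

theorem IsPositiveCompatible.apply_apply (hΩ : IsSymplecticForm Ω) (hJ : IsAlmostComplex J)
    (h : IsPositiveCompatible Ω J) (x : M) (u v : TangentSpace I x) :
    Ω x (J x u) (J x v) = Ω x u v := by
  rw [h.apply_left hΩ, hJ.sq, map_neg, neg_neg]

theorem IsAlmostComplex.contMDiffAt (hJ : IsAlmostComplex J) {X : Π x : M, TangentSpace I x}
    {x : M} (hX : CMDiffAt ∞ (T% X) x) : CMDiffAt ∞ (T% (fun y ↦ J y (X y))) x :=
  ContMDiffAt.clm_bundle_apply (F₁ := E) (F₂ := E) (hJ.contMDiff x) hX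

/-- The covariant derivative `(∇_v J) Y` of the field of endomorphisms `J`. -/
noncomputable def covDerivEnd (cov : CovariantDerivative I E (TangentSpace I : M → Type _))
    (J : Π x : M, TangentSpace I x →L[ℝ] TangentSpace I x) (Y : Π x : M, TangentSpace I x)
    (x : M) (v : TangentSpace I x) : TangentSpace I x :=
  cov (fun y ↦ J y (Y y)) x v - J x (cov Y x v)

theorem cov_fun_neg (cov : CovariantDerivative I E (TangentSpace I : M → Type _))
    {Y : Π x : M, TangentSpace I x} {x : M} (hY : MDiffAt (T% Y) x) :
    cov (fun y ↦ -Y y) x = -cov Y x := by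
  have h := (cov.isCovariantDerivativeOn (s := Set.univ)).smul_const (-1 : ℝ) hY (Set.mem_univ x)
  have e : (fun y ↦ -Y y) = (-1 : ℝ) • Y := by ext y; simp
  rw [e]
  exact h.trans (by simp)

/-- Differentiating `J² = -1` shows that `∇J` anticommutes with `J`; any connection will do. -/
theorem covDerivEnd_apply (hJ : IsAlmostComplex J)
    (cov : CovariantDerivative I E (TangentSpace I : M → Type _))
    {Y : Π x : M, TangentSpace I x} {x : M} (hY : MDiffAt (T% Y) x) (v : TangentSpace I x) :
    covDerivEnd cov J (fun y ↦ J y (Y y)) x v = -J x (covDerivEnd cov J Y x v) := by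
  simp only [covDerivEnd, hJ.sq, cov_fun_neg cov hY, map_sub, neg_apply]
  abel

variable [FiniteDimensional ℝ E]

/-! ### Symmetries and smoothness of the Nijenhuis tensor -/

theorem nijenhuis_swap (hJ : IsAlmostComplex J) (x : M) (u v : TangentSpace I x) :
    nijenhuis hJ x u v = -nijenhuis hJ x v u := by
  have hu := mdifferentiableAt_extend I E u
  have hv := mdifferentiableAt_extend I E v
  have h1 := nijenhuis_apply hJ hu hv
  have h2 := nijenhuis_apply hJ hv hu
  rw [nijenhuisBracket_swap, ← h2] at h1
  simpa using h1

theorem nijenhuis_apply_left (hJ : IsAlmostComplex J) (x : M) (u v : TangentSpace I x) :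
    nijenhuis hJ x (J x u) v = -J x (nijenhuis hJ x u v) := by
  have : CompleteSpace E := FiniteDimensional.complete ℝ E
  have hu := mdifferentiableAt_extend I E u
  have hv := mdifferentiableAt_extend I E v
  have h1 := nijenhuis_apply hJ hu hv
  have h2 := nijenhuis_apply hJ (hJ.mdifferentiableAt hu) hv
  simp only [extend_apply_self] at h1 h2
  have e : (fun y ↦ -extend E u y) = (-1 : ℝ) • extend E u := by
    ext y; simp
  rw [h1, h2]
  simp only [nijenhuisBracket, hJ.sq, e, mlieBracket_const_smul_left hu, map_sub, map_smul]
  module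

/-- Needed because `N(Y, Z)` is itself differentiated covariantly later on. -/
theorem contMDiffAt_nijenhuis (hJ : IsAlmostComplex J) {Y Z : Π x : M, TangentSpace I x}
    {x : M} (hY : CMDiffAt ∞ (T% Y) x) (hZ : CMDiffAt ∞ (T% Z) x) :
    CMDiffAt ∞ (T% (fun y ↦ nijenhuis hJ y (Y y) (Z y))) x := by
  have : CompleteSpace E := FiniteDimensional.complete ℝ E
  have : IsManifold I (((⊤ : ℕ∞) : ℕ∞ω) + 1) M := inferInstanceAs (IsManifold I ∞ M)
  have : IsManifold I (minSmoothness ℝ 2) M := by simpa using inferInstanceAs (IsManifold I 2 M)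
  have hb : ∀ {U V : Π x : M, TangentSpace I x}, CMDiffAt ∞ (T% U) x → CMDiffAt ∞ (T% V) x →
      CMDiffAt ∞ (T% (mlieBracket I U V)) x := fun hU hV ↦
    ContMDiffAt.mlieBracket_vectorField (m := ⊤) (n := ⊤) hU hV (by simp)
  have h : CMDiffAt ∞ (T% (fun y ↦ nijenhuisBracket J y Y Z)) x :=
    (((hb (hJ.contMDiffAt hY) (hJ.contMDiffAt hZ)).sub_section
      (hJ.contMDiffAt (hb (hJ.contMDiffAt hY) hZ))).sub_section
      (hJ.contMDiffAt (hb hY (hJ.contMDiffAt hZ)))).sub_section (hb hY hZ)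
  refine h.congr_of_eventuallyEq ?_
  -- The tensor agrees with the bracket expression wherever `Y` and `Z` are differentiable. Lowering
  -- the order to 1 makes regularity at `x` spread to a neighbourhood, which fails for order `∞`.
  filter_upwards [(contMDiffAt_iff_contMDiffAt_nhds (n := 1) (by simp)).1
      (ContMDiffAt.of_le hY (by simp)),
    (contMDiffAt_iff_contMDiffAt_nhds (n := 1) (by simp)).1
      (ContMDiffAt.of_le hZ (by simp))] with y hy hz
  rw [nijenhuis_apply hJ (hy.mdifferentiableAt (by simp)) (hz.mdifferentiableAt (by simp))]

/-! ### Almost Kähler identities for the Levi-Civita connection -/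

section LeviCivita

variable {hΩ : IsSymplecticForm Ω} {hJ : IsAlmostComplex J} {h : IsPositiveCompatible Ω J}
  {cov : CovariantDerivative I E (TangentSpace I : M → Type _)}
  {X Y Z : Π x : M, TangentSpace I x} {x : M}

theorem IsLeviCivita.mlieBracket_eq
    {g : ContMDiffRiemannianMetric I ∞ E (fun x : M ↦ TangentSpace I x)} (hcov : IsLeviCivita g cov) (hX : MDiffAt (T% X) x) (hY : MDiffAt (T% Y) x) :
    mlieBracket I X Y x = cov Y x (X x) - cov X x (Y x) := by
  have : CompleteSpace E := FiniteDimensional.complete ℝ E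
  exact ((CovariantDerivative.torsion_eq_zero_iff cov).1 hcov.1 hX hY).symm

/-- Since `Ω(Y, Z) = g(JY, Z)` and `∇g = 0`, the derivative of `Ω` is carried by that of `J`: `(∇_v
Ω)(Y, Z) = g((∇_v J)Y, Z)`. -/
theorem IsLeviCivita.mvfderiv_symplectic (hcov : IsLeviCivita (compatibleMetric hΩ hJ h) cov)
    (hY : MDiffAt (T% Y) x) (hZ : MDiffAt (T% Z) x) (v : TangentSpace I x) :
    d% (fun y ↦ Ω y (Y y) (Z y)) x v = Ω x (cov Y x v) (Z x) + Ω x (Y x) (cov Z x v)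
      + Ω x (covDerivEnd cov J Y x v) (J x (Z x)) := by
  have h1 := hcov.2 (fun y ↦ J y (Y y)) Z x v (hJ.mdifferentiableAt hY) hZ
  change d% (fun y ↦ Ω y (J y (Y y)) (J y (Z y))) x v =
    Ω x (cov (fun y ↦ J y (Y y)) x v) (J x (Z x)) + Ω x (J x (Y x)) (J x (cov Z x v)) at h1
  simp only [h.apply_apply hΩ hJ] at h1
  rw [h1]
  simp only [covDerivEnd, map_sub, sub_apply, h.apply_apply hΩ hJ]
  ring

/-- `J` is `g`-skew and `∇g = 0`, so `∇J` is skew too: compare the derivatives of `Ω(Y, Z)` written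
as `g(JY, Z)` and as `-g(Y, JZ)`. -/
theorem IsLeviCivita.covDerivEnd_skew (hcov : IsLeviCivita (compatibleMetric hΩ hJ h) cov)
    (hY : MDiffAt (T% Y) x) (hZ : MDiffAt (T% Z) x) (v : TangentSpace I x) :
    Ω x (covDerivEnd cov J Y x v) (J x (Z x)) = -Ω x (Y x) (J x (covDerivEnd cov J Z x v)) := by
  have h1 := hcov.mvfderiv_symplectic hY hZ v
  have h2 := hcov.2 Y (fun y ↦ J y (Z y)) x v hY (hJ.mdifferentiableAt hZ)
  change d% (fun y ↦ Ω y (Y y) (J y (J y (Z y)))) x v =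
    Ω x (cov Y x v) (J x (J x (Z x))) + Ω x (Y x) (J x (cov (fun y ↦ J y (Z y)) x v)) at h2
  have h3 : d% (fun y ↦ Ω y (Y y) (J y (J y (Z y)))) x v = -d% (fun y ↦ Ω y (Y y) (Z y)) x v := by
    have e : (fun y ↦ Ω y (Y y) (J y (J y (Z y)))) = -fun y ↦ Ω y (Y y) (Z y) := by
      ext y; simp [hJ.sq]
    rw [e, mvfderiv_neg]
    rfl
  rw [h3, hJ.sq, map_neg] at h2
  simp only [covDerivEnd, map_sub, hJ.sq, map_neg] at h1 ⊢
  linarith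

/-- For a torsion-free connection `dΩ` is the cyclic sum of `∇Ω`; this is where closedness enters.
-/
theorem IsLeviCivita.covDerivEnd_cyclic (hcov : IsLeviCivita (compatibleMetric hΩ hJ h) cov)
    (hX : CMDiffAt ∞ (T% X) x) (hY : CMDiffAt ∞ (T% Y) x) (hZ : CMDiffAt ∞ (T% Z) x) :
    Ω x (covDerivEnd cov J X x (Y x)) (J x (Z x)) + Ω x (covDerivEnd cov J Y x (Z x)) (J x (X x))
      + Ω x (covDerivEnd cov J Z x (X x)) (J x (Y x)) = 0 := by
  have dX := hX.mdifferentiableAt (by simp)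
  have dY := hY.mdifferentiableAt (by simp)
  have dZ := hZ.mdifferentiableAt (by simp)
  have h0 := hΩ.closed X Y Z x hX hY hZ
  have h1 := hcov.covDerivEnd_skew dY dZ (X x)
  rw [extDerivTwoForm, hcov.mvfderiv_symplectic dY dZ, hcov.mvfderiv_symplectic dX dZ,
    hcov.mvfderiv_symplectic dX dY, hcov.mlieBracket_eq dX dY, hcov.mlieBracket_eq dX dZ,
    hcov.mlieBracket_eq dY dZ] at h0
  have h2 := h.symm x (Y x) (covDerivEnd cov J Z x (X x))
  have h3 := hcov.covDerivEnd_skew dX dY (Z x)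
  have h4 := h.symm x (X x) (covDerivEnd cov J Y x (Z x))
  simp only [compatibleTensor_apply] at h2 h4
  simp only [map_sub, sub_apply] at h0
  rw [hΩ.swap x (Y x) (cov Z x _), hΩ.swap x (X x) (cov Z x _),
    hΩ.swap x (X x) (cov Y x _)] at h0
  linarith

theorem IsLeviCivita.two_mul_covDerivEnd (hcov : IsLeviCivita (compatibleMetric hΩ hJ h) cov)
    (hX : CMDiffAt ∞ (T% X) x) (hY : CMDiffAt ∞ (T% Y) x) (hZ : CMDiffAt ∞ (T% Z) x) :
    2 * Ω x (covDerivEnd cov J Y x (X x)) (J x (Z x)) =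
      Ω x (nijenhuis hJ x (Y x) (Z x)) (J x (J x (X x))) := by
  have dX := hX.mdifferentiableAt (by simp)
  have dY := hY.mdifferentiableAt (by simp)
  have dZ := hZ.mdifferentiableAt (by simp)
  have dJY := hJ.mdifferentiableAt dY
  have dJZ := hJ.mdifferentiableAt dZ
  -- With zero torsion the brackets become covariant derivatives, and all terms without a derivative
  -- of `J` cancel.
  have hNYZ : nijenhuis hJ x (Y x) (Z x) =
      covDerivEnd cov J Z x (J x (Y x)) - covDerivEnd cov J Y x (J x (Z x))
        + J x (covDerivEnd cov J Y x (Z x)) - J x (covDerivEnd cov J Z x (Y x)) := by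
    rw [nijenhuis_apply hJ dY dZ, nijenhuisBracket, hcov.mlieBracket_eq dJY dJZ,
      hcov.mlieBracket_eq dJY dZ, hcov.mlieBracket_eq dY dJZ, hcov.mlieBracket_eq dY dZ]
    simp only [covDerivEnd, map_sub, hJ.sq]
    abel
  have skew : ∀ {U V : Π x : M, TangentSpace I x} (v : TangentSpace I x), MDiffAt (T% U) x →
      MDiffAt (T% V) x → Ω x (covDerivEnd cov J U x v) (J x (V x)) =
        -Ω x (covDerivEnd cov J V x v) (J x (U x)) := fun {U V} v hU hV ↦ by
    rw [hcov.covDerivEnd_skew hU hV, ← compatibleTensor_apply, h.symm, compatibleTensor_apply]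
  have c1 := hcov.covDerivEnd_cyclic hX hY hZ
  -- Replacing `(Y, Z)` by `(JY, JZ)` flips the sign of the term containing `∇_X J`. Subtracting
  -- from `c1` doubles that term, and the other four assemble into `N(Y, Z)`.
  have c2 := hcov.covDerivEnd_cyclic hX (hJ.contMDiffAt hY) (hJ.contMDiffAt hZ)
  have s1 := skew (X x) dY dZ
  have s2 := skew (J x (Y x)) dX dJZ
  have s3 := skew (Y x) dX dZ
  rw [hNYZ]
  simp only [covDerivEnd_apply hJ cov dY, covDerivEnd_apply hJ cov dZ, h.apply_left hΩ, hJ.sq,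
    map_sub, map_add, map_neg, sub_apply, add_apply, neg_apply, neg_neg] at c1 c2 s1 s2 s3 ⊢
  linarith

/-! ### Parallel Nijenhuis tensor -/

/-- Obtained by differentiating `N(JY, Z) = -J N(Y, Z)` with `N` constant; torsion and metric play
no role. -/
theorem IsParallel.covDerivEnd_nijenhuis (hN : IsParallel cov (nijenhuis hJ))
    (hY : CMDiffAt ∞ (T% Y) x) (hZ : CMDiffAt ∞ (T% Z) x) (v : TangentSpace I x) :
    nijenhuis hJ x (covDerivEnd cov J Y x v) (Z x) =
      -covDerivEnd cov J (fun y ↦ nijenhuis hJ y (Y y) (Z y)) x v := by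
  have hNYZ := contMDiffAt_nijenhuis hJ hY hZ
  have h1 := hN x v Y Z hY hZ
  have h2 := hN x v (fun y ↦ J y (Y y)) Z (hJ.contMDiffAt hY) hZ
  simp only [nijenhuis_apply_left] at h2
  rw [cov_fun_neg cov ((hJ.contMDiffAt hNYZ).mdifferentiableAt (by simp))] at h2
  rw [sub_sub, sub_eq_zero] at h1
  simp only [covDerivEnd, h1, map_sub, map_add, sub_apply, neg_apply, nijenhuis_apply_left] at h2 ⊢
  rw [← sub_eq_zero, ← neg_zero, ← h2]
  abel

theorem IsLeviCivita.nijenhuis_eq_zero (hcov : IsLeviCivita (compatibleMetric hΩ hJ h) cov)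
    (hN : IsParallel cov (nijenhuis hJ)) (x : M) : nijenhuis hJ x = 0 := by
  have hE : ∀ u : TangentSpace I x, CMDiffAt ∞ (T% (extend E u)) x := fun u ↦
    contMDiffAt_extend I E u
  have dE : ∀ u : TangentSpace I x, MDiffAt (T% (extend E u)) x := fun u ↦
    mdifferentiableAt_extend I E u
  have key : ∀ (w z : TangentSpace I x) {Y : Π x : M, TangentSpace I x},
      CMDiffAt ∞ (T% Y) x → 2 * compatibleTensor Ω J x (covDerivEnd cov J Y x w) z =
        compatibleTensor Ω J x (nijenhuis hJ x (Y x) z) (J x w) := fun w z Y hY ↦ by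
    simpa using hcov.two_mul_covDerivEnd (hE w) hY (hE z)
  -- The right side of `key` sees only the value `Y x`, so by definiteness of the metric `∇J` is
  -- tensorial in `Y`. This lets arbitrary extensions of vectors define the pointwise map `A`.
  have tens : ∀ (w : TangentSpace I x) {Y : Π x : M, TangentSpace I x},
      CMDiffAt ∞ (T% Y) x →
        covDerivEnd cov J Y x w = covDerivEnd cov J (extend E (Y x)) x w := fun w Y hY ↦ by
    by_contra hne
    have hp := h.pos x _ (sub_ne_zero.2 hne)
    generalize hd : covDerivEnd cov J Y x w - covDerivEnd cov J (extend E (Y x)) x w = d at hp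
    have h1 := key w d hY
    have h2 := key w d (hE (Y x))
    rw [extend_apply_self, ← h1] at h2
    nth_rw 1 [← hd] at hp
    rw [map_sub, sub_apply] at hp
    linarith
  refine eq_zero_of_compatible_derivation (compatibleTensor Ω J x) (J x) (nijenhuis hJ x)
    (fun w y ↦ covDerivEnd cov J (extend E y) x w) (h.symm x) (h.pos x) (hJ.sq x) ?_ ?_ ?_ ?_
  · intro w y z
    simpa using key w z (hE y)
  · intro w y
    simpa [tens w (hJ.contMDiffAt (hE y))] using covDerivEnd_apply hJ cov (dE y) w
  · intro w y z
    simpa using hcov.covDerivEnd_skew (dE y) (dE z) w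
  · intro w y z
    simpa [tens w (contMDiffAt_nijenhuis hJ (hE y) (hE z))] using
      hN.covDerivEnd_nijenhuis (hE y) (hE z) w

end LeviCivita

end AlmostKahler

theorem mainTheorem3
    {E : Type*} [NormedAddCommGroup E] [NormedSpace ℝ E] [FiniteDimensional ℝ E]
    {H : Type*} [TopologicalSpace H] (I : ModelWithCorners ℝ E H)
    {M : Type*} [TopologicalSpace M] [ChartedSpace H M] [IsManifold I ∞ M]
    (Ω : Π x : M, TangentSpace I x →L[ℝ] TangentSpace I x →L[ℝ] ℝ)
    (J : Π x : M, TangentSpace I x →L[ℝ] TangentSpace I x)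
    (hΩ : AlmostKahler.IsSymplecticForm Ω)
    (hJ : AlmostKahler.IsAlmostComplex J)
    (hΩJ : AlmostKahler.IsPositiveCompatible Ω J) :
    AlmostKahler.IsParallel
        (AlmostKahler.leviCivita (AlmostKahler.compatibleMetric hΩ hJ hΩJ))
        (AlmostKahler.nijenhuis hJ) ↔
      ∀ x : M, AlmostKahler.nijenhuis hJ x = 0 := by
  refine ⟨fun hN ↦ (AlmostKahler.leviCivita_spec _).nijenhuis_eq_zero hN,
    fun h0 x v Y Z _ _ ↦ ?_⟩
  have e : (fun y ↦ AlmostKahler.nijenhuis hJ y (Y y) (Z y)) = 0 := by ext y; simp [h0]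
  rw [e, CovariantDerivative.zero]
  simp [h0]
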